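/- \textbf{Setting.} A (finite-horizon) Dec-POMDP $D$ consists of agents $\mathcal N=\{1,\dots,N\}$, a finite state set $\mathcal S$, finite action and observation sets $\mathcal A_i,\mathcal O_i$ for $i\in\mathcal N$ (with $\mathcal A=\prod_i\mathcal A_i$, $\mathcal O=\prod_i\mathcal O_i$), kernels $P:\mathcal S\times\mathcal A\to\Delta(\mathcal S)$ and $O:\mathcal S\times\mathcal A\to\Delta(\mathcal O)$, a reward $\mathcal R:\mathcal S\times\mathcal A\to\mathbb R$, an initial distribution $b_0\in\Delta(\mathcal S)$ and a horizon $T\in\mathbb N_0$. A local policy $\pi_i\in\Pi_i$ assigns to every history $\tau_{i,t}\in(\mathcal A_i\times\mathcal O_i)^t$, $0\le t\le T$, an element of $\Delta(\mathcal A_i)$; $\Pi^D=\prod_i\Pi_i$ carries its Borel $\sigma$-algebra, and $\Delta(\Pi^D)$ is the set of probability measures on it. Under $\mathbb P_\pi$, $S_0\sim b_0$, $A_{i,t}\sim\pi_i(\cdot\mid\overline{AO}_{i,t})$ independently over $i$, where $\overline{AO}_{i,t}=(A_{i,0},O_{i,1},\dots,A_{i,t-1},O_{i,t})$, $S_{t+1}\sim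 P(\cdot\mid S_t,A_t)$ and $O_{t+1}\sim O(\cdot\mid S_{t+1},A_t)$; and $J^D(\pi)=\mathbb E_\pi[\sum_{t=0}^T\mathcal R(S_t,A_t)]$. An isomorphism $f\in\mathrm{Iso}(D,E)$ between Dec-POMDPs of equal horizon is a tuple of bijections $f_N:\mathcal N^D\to\mathcal N^E$, $f_S:\mathcal S^D\to\mathcal S^E$, $f_{A_i}:\mathcal A_i^D\to\mathcal A^E_{f_N(i)}$, $f_{O_i}:\mathcal O_i^D\to\mathcal O^E_{f_N(i)}$ which preserves $P$, $O$, $\mathcal R$ and $b_0$; $\mathrm{Aut}(D)=\mathrm{Iso}(D,D)$. The pushforward $f^*\pi\in\Pi^E$ of $\pi\in\Pi^D$ is $(f^*\pi)_j(a\mid\tau)=\pi_{f^{-1}j}(f^{-1}a\mid f^{-1}\tau)$, and $f^*\nu$ is the image of $\nu\in\Delta(\Pi^D)$ under $\pi\mapsto f^*\pi$. A labeling $f\in\mathrm{Sym}(D)$ is a tuple of bijections $\mathcal N\to\{1,\dots,N\}$, $\mathcal S\to\{1,\dots,|\mathcal S|\}$, $\mathcal A_i\to\{1,\dots,|\mathcal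 A_i|\}$, $\mathcal O_i\to\{1,\dots,|\mathcal O_i|\}$; $f^*D$ is the Dec-POMDP obtained from $D$ by renaming everything along $f$; and $\mathcal D=\{f^*D\mid f\in\mathrm{Sym}(D)\}$, a finite set. A learning algorithm $\sigma\in\Sigma^{\mathcal D}$ assigns to each $E\in\mathcal D$ some $\sigma(E)\in\Delta(\Pi^E)$. With $\mathcal U$ denoting uniform distributions and all draws independent, the payoff of the label-free coordination (LFC) game for $D$ is \[U^D(\boldsymbol\sigma)=\mathbb E_{D_i\sim\mathcal U(\mathcal D),\,i\in\mathcal N}\Big[\mathbb E_{f_j\sim\mathcal U(\mathrm{Iso}(D_j,D)),\,j\in\mathcal N}\Big[\mathbb E_{\pi^{(k)}\sim f_k^*\boldsymbol\sigma_k(D_k),\,k\in\mathcal N}\big[J^D\big((\pi^{(l)}_l)_{l\in\mathcal N}\big)\big]\Big]\Big].\] For $\mu\in\Delta(\Pi^D)$ let $\mathbb P_\mu$ be the law of an episode in which first $\pi\sim\mu$ is drawn and then followed. For $\mu_i\in\Delta(\Pi_i)$, the local policy $\pi_i^{\mu_i}$ is $\pi_i^{\mu_i}(a\mid\tau_{i,t})=\mathbb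 P_{\mu_i\otimes\mu_{-i}}(A_{i,t}=a\mid\overline{AO}_{i,t}=\tau_{i,t})$ for any product distribution $\mu_{-i}$ over the other agents' local policies for which the condition has positive probability, and $1/|\mathcal A_i|$ if there is none. The symmetrizer $\Psi:\Pi^D\to\Pi^D$ is $\Psi_i(\pi)=\pi_i^{\mu_i}$, where $\mu_i$ is the $i$-th marginal of the other-play distribution $\mu=|\mathrm{Aut}(D)|^{-N}\sum_{\mathbf g\in\mathrm{Aut}(D)^{\mathcal N}}\delta_{((\mathbf g_i^*\pi)_i)_{i\in\mathcal N}}$ of $\pi$. Policies $\pi,\pi'\in\Pi^D$ are equivalent, $\pi\equiv_D\pi'$, if $\Psi(\pi)=\Psi(\pi')$. \textbf{Theorem.} Let $D$ be a Dec-POMDP, let $\boldsymbol\sigma_1,\dots,\boldsymbol\sigma_N\in\Sigma^{\mathcal D}$, and for every $E\in\mathcal D$ choose $f_{E,D}\in\mathrm{Iso}(E,D)$ arbitrarily. Then \[U^D(\boldsymbol\sigma)=\mathbb E_{D_i\sim\mathcal U(\mathcal D),\,i\in\mathcal N}\Big[\mathbb E_{\pi^{(j)}\sim f_{D_j,D}^*\boldsymbol\sigma_j(D_j),\,j\in\mathcal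 N}\Big[J^D\big((\Psi_k(\pi^{(k)}))_{k\in\mathcal N}\big)\Big]\Big].\] In particular, the payoff depends only on equivalence classes: if $\rho^{(1)},\dots,\rho^{(N)}\in\Pi^D$ are such that for all $k\in\mathcal N$ and $E\in\mathcal D$, $f_{E,D}^*p\equiv_D\rho^{(k)}$ for $\boldsymbol\sigma_k(E)$-almost every $p$, then $U^D(\boldsymbol\sigma)=J^D\big((\Psi_k(\rho^{(k)}))_{k\in\mathcal N}\big)$. (If all $\rho^{(k)}$ equal one policy $\rho$, this value is $J^D(\Psi(\rho))$.) -/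

import Mathlib

open MeasureTheory
open scoped BigOperators ENNReal

universe u v w

noncomputable section

/-- A finite-horizon Dec-POMDP. `Δ(X)` for a finite set `X` is `stdSimplex ℝ X`. The agents are the
elements of `Fin N`; a joint action (observation) is a dependent function on the agents. The time
steps are `0, …, T`. -/
structure DecPOMDP : Type (u + 1) where
  N : ℕ
  State : Type u
  [fintypeState : Fintype State]
  Act : Fin N → Type u
  [fintypeAct : ∀ i, Fintype (Act i)]
  Obs : Fin N → Type u
  [fintypeObs : ∀ i, Fintype (Obs i)]
  /-- `trans s a s'` is `P(s' ∣ s, a)`. -/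
  trans : State → (∀ i, Act i) → stdSimplex ℝ State
  reward : State → (∀ i, Act i) → ℝ
  /-- `obsKer s a o` is `O(o ∣ s, a)`, with `s` the new state and `a` the previous joint action. -/
  obsKer : State → (∀ i, Act i) → stdSimplex ℝ (∀ i, Obs i)
  init : stdSimplex ℝ State
  T : ℕ

/-- Transport of a probability mass function along a bijection: `y ↦ p (e⁻¹ y)`. -/
def simplexMap {X : Type v} {Y : Type w} [Fintype X] [Fintype Y] (e : X ≃ Y)
    (p : stdSimplex ℝ X) : stdSimplex ℝ Y :=
  ⟨fun y => p (e.symm y), fun y => p.2.1 _, by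
    rw [Equiv.sum_comp e.symm (fun x => p x)]; exact p.2.2⟩

/-- The uniform distribution on a nonempty finite set. -/
def uniformSimplex (X : Type v) [Fintype X] [Nonempty X] : stdSimplex ℝ X :=
  ⟨fun _ => 1 / (Fintype.card X : ℝ), fun _ => by positivity, by
    simp [Finset.sum_const, Finset.card_univ]⟩

namespace DecPOMDP

attribute [instance] fintypeState fintypeAct fintypeObs

/-- Joint actions. -/
abbrev JAct (D : DecPOMDP.{u}) : Type u := ∀ i, D.Act i

/-- Joint observations. -/
abbrev JObs (D : DecPOMDP.{u}) : Type u := ∀ i, D.Obs i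

/-- Action-observation histories of agent `i` of length `t`; entry `k` is the pair
`(A_{i,k}, O_{i,k+1})`. -/
abbrev AOHist (D : DecPOMDP.{u}) (i : Fin D.N) (t : ℕ) : Type u :=
  Fin t → D.Act i × D.Obs i

/-- Local policies of agent `i`: `π_i t τ a` is `π_i(a ∣ τ)` for a history `τ` of length `t ≤ T`.
The σ-algebra is the Borel one, inherited from the product of copies of `ℝ`. -/
abbrev LocalPolicy (D : DecPOMDP.{u}) (i : Fin D.N) : Type u :=
  (t : Fin (D.T + 1)) → D.AOHist i t → stdSimplex ℝ (D.Act i)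

/-- Joint policies, with the product σ-algebra. -/
abbrev Policy (D : DecPOMDP.{u}) : Type u := (i : Fin D.N) → D.LocalPolicy i

/-- The sample space `Ω`: all states `S_0, …, S_T`, joint actions `A_0, …, A_T` and joint
observations `O_1, …, O_T` of an episode (entry `k` of the last component is `O_{k+1}`). The rewards
are functions of these. -/
abbrev Traj (D : DecPOMDP.{u}) : Type u :=
  (Fin (D.T + 1) → D.State) × (Fin (D.T + 1) → D.JAct) × (Fin D.T → D.JObs)

/-- The action-observation history of agent `i` at time `t` in the episode `ω`. -/
def aoHist {D : DecPOMDP.{u}} (ω : D.Traj) (i : Fin D.N) (t : Fin (D.T + 1)) : D.AOHist i t :=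
  fun k => (ω.2.1 ⟨k, by omega⟩ i, ω.2.2 ⟨k, by omega⟩ i)

/-- `ℙ_π({ω})`: the state `S_0` is drawn from the initial distribution, each `S_{t+1}` from
`P(· ∣ S_t, A_t)`, each `O_{t+1}` from `O(· ∣ S_{t+1}, A_t)`, and each `A_{i,t}` from
`π_i(· ∣ AO_{i,t})`, independently over the agents `i`. -/
def trajProb {D : DecPOMDP.{u}} (π : D.Policy) (ω : D.Traj) : ℝ :=
  D.init (ω.1 0) *
    (∏ t : Fin D.T, D.trans (ω.1 t.castSucc) (ω.2.1 t.castSucc) (ω.1 t.succ) *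
      D.obsKer (ω.1 t.succ) (ω.2.1 t.castSucc) (ω.2.2 t)) *
    ∏ t : Fin (D.T + 1), ∏ i : Fin D.N, π i t (aoHist ω i t) (ω.2.1 t i)

/-- The self-play objective `J^D(π) = 𝔼_π[∑_{t=0}^T R(S_t, A_t)]`. -/
def J {D : DecPOMDP.{u}} (π : D.Policy) : ℝ :=
  ∑ ω : D.Traj, trajProb π ω * ∑ t : Fin (D.T + 1), D.reward (ω.1 t) (ω.2.1 t)

/-! ### Isomorphisms, pushforward, relabelings -/

/-- Dec-POMDP isomorphisms. The joint map `f_A`, `(f_A a)_{f_N i} = f_{A_i} (a_i)`, is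
`Equiv.piCongr fN fA`, and similarly for observations. -/
structure Iso (D : DecPOMDP.{u}) (E : DecPOMDP.{v}) where
  fN : Fin D.N ≃ Fin E.N
  fS : D.State ≃ E.State
  fA : ∀ i, D.Act i ≃ E.Act (fN i)
  fO : ∀ i, D.Obs i ≃ E.Obs (fN i)
  horizon_eq : D.T = E.T
  trans_eq : ∀ s a s', D.trans s a s' = E.trans (fS s) (Equiv.piCongr fN fA a) (fS s')
  obs_eq : ∀ s a o, D.obsKer s a o =
    E.obsKer (fS s) (Equiv.piCongr fN fA a) (Equiv.piCongr fN fO o)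
  reward_eq : ∀ s a, D.reward s a = E.reward (fS s) (Equiv.piCongr fN fA a)
  init_eq : ∀ s, D.init s = E.init (fS s)

instance (D : DecPOMDP.{u}) (E : DecPOMDP.{v}) : Finite (Iso D E) := by
  refine Finite.of_injective
    (β := Σ e : Fin D.N ≃ Fin E.N, (D.State ≃ E.State) × (∀ i, D.Act i ≃ E.Act (e i)) ×
      (∀ i, D.Obs i ≃ E.Obs (e i))) (fun f => ⟨f.fN, f.fS, f.fA, f.fO⟩) ?_
  rintro ⟨a, b, c, d, _⟩ ⟨a', b', c', d', _⟩ h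
  simp only [Sigma.mk.injEq] at h
  obtain ⟨rfl, h⟩ := h
  simp only [heq_eq_eq, Prod.mk.injEq] at h
  obtain ⟨rfl, rfl, rfl⟩ := h
  rfl

instance (D : DecPOMDP.{u}) (E : DecPOMDP.{v}) : Fintype (Iso D E) := Fintype.ofFinite _

/-- Automorphisms. -/
abbrev Aut (D : DecPOMDP.{u}) : Type u := Iso D D

lemma piCongr_refl {n : ℕ} {X : Fin n → Type u} (x : ∀ i, X i) :
    Equiv.piCongr (W := X) (Z := X) (Equiv.refl _) (fun i => Equiv.refl (X i)) x = x := by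
  funext i
  exact Equiv.piCongr_apply_apply (W := X) (Z := X) (Equiv.refl _) (fun i => Equiv.refl (X i)) x i

instance (D : DecPOMDP.{u}) : Nonempty (Aut D) :=
  ⟨{ fN := Equiv.refl _
     fS := Equiv.refl _
     fA := fun i => Equiv.refl _
     fO := fun i => Equiv.refl _
     horizon_eq := rfl
     trans_eq := fun s a s' => by rw [piCongr_refl]; rfl
     obs_eq := fun s a o => by rw [piCongr_refl, piCongr_refl]; rfl
     reward_eq := fun s a => by rw [piCongr_refl]; rfl
     init_eq := fun s => rfl }⟩

namespace Iso

variable {D : DecPOMDP.{u}} {E : DecPOMDP.{v}}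

/-- The local policy of agent `f i` obtained from a local policy of agent `i` by precomposition with
`f⁻¹`: `(a ∣ τ) ↦ π_i(f⁻¹ a ∣ f⁻¹ τ)`. -/
def pushLocal (f : Iso D E) (i : Fin D.N) (p : D.LocalPolicy i) : E.LocalPolicy (f.fN i) :=
  fun t τ => simplexMap (f.fA i)
    (p (Fin.cast (congrArg (· + 1) f.horizon_eq.symm) t)
      (fun k => ((f.fA i).symm (τ k).1, (f.fO i).symm (τ k).2)))

/-- The pushforward policy `f^*π`: agent `f i` gets the local policy of `i`, precomposed with
`f⁻¹`. -/
def push (f : Iso D E) (π : D.Policy) : E.Policy :=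
  Equiv.piCongrLeft (fun j => E.LocalPolicy j) f.fN (fun i => f.pushLocal i (π i))

lemma push_apply (f : Iso D E) (π : D.Policy) (i : Fin D.N) :
    f.push π (f.fN i) = f.pushLocal i (π i) :=
  Equiv.piCongrLeft_apply_apply (fun j => E.LocalPolicy j) f.fN _ i

lemma measurable_push (f : Iso D E) : Measurable (f.push : D.Policy → E.Policy) := by
  refine measurable_pi_lambda _ fun j => ?_
  obtain ⟨i, rfl⟩ := f.fN.surjective j
  simp only [push_apply]
  refine measurable_pi_lambda _ fun t => measurable_pi_lambda _ fun τ => ?_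
  refine Measurable.subtype_mk (measurable_pi_lambda _ fun a => ?_)
  have h1 : Measurable fun π : D.Policy =>
      π i (Fin.cast (congrArg (· + 1) f.horizon_eq.symm) t)
        (fun k => ((f.fA i).symm (τ k).1, (f.fO i).symm (τ k).2)) := by
    fun_prop
  exact (measurable_pi_apply _).comp (measurable_subtype_coe.comp h1)

/-- The pushforward `f^*ν = ν ∘ (f^*)⁻¹` of a distribution over policies. -/
def pushDist (f : Iso D E) (ν : ProbabilityMeasure D.Policy) : ProbabilityMeasure E.Policy :=
  ν.map f.measurable_push.aemeasurable

end Iso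

/-- Labelings of `D`; `{1, …, k}` is represented by `Fin k`. -/
structure Labeling (D : DecPOMDP.{u}) where
  fN : Fin D.N ≃ Fin D.N
  fS : D.State ≃ Fin (Fintype.card D.State)
  fA : ∀ i, D.Act i ≃ Fin (Fintype.card (D.Act i))
  fO : ∀ i, D.Obs i ≃ Fin (Fintype.card (D.Obs i))

namespace Labeling

variable {D : DecPOMDP.{u}}

instance : Finite (Labeling D) := by
  refine Finite.of_injective (fun f => (f.fN, f.fS, f.fA, f.fO)) ?_
  rintro ⟨a, b, c, d⟩ ⟨a', b', c', d'⟩ h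
  simp only [Prod.mk.injEq] at h
  obtain ⟨rfl, rfl, rfl, rfl⟩ := h
  rfl

instance : Nonempty (Labeling D) :=
  ⟨⟨Equiv.refl _, Fintype.equivFin _, fun _ => Fintype.equivFin _, fun _ => Fintype.equivFin _⟩⟩

/-- `f⁻¹` on joint actions of the relabeled problem. -/
def invA (f : Labeling D) :
    (∀ i, Fin (Fintype.card (D.Act (f.fN.symm i)))) ≃ D.JAct :=
  Equiv.piCongr f.fN.symm (fun i => (f.fA (f.fN.symm i)).symm)

/-- `f⁻¹` on joint observations of the relabeled problem. -/
def invO (f : Labeling D) :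
    (∀ i, Fin (Fintype.card (D.Obs (f.fN.symm i)))) ≃ D.JObs :=
  Equiv.piCongr f.fN.symm (fun i => (f.fO (f.fN.symm i)).symm)

/-- The relabeled Dec-POMDP `f^*D`. -/
def relabel (f : Labeling D) : DecPOMDP.{0} where
  N := D.N
  State := Fin (Fintype.card D.State)
  Act i := Fin (Fintype.card (D.Act (f.fN.symm i)))
  Obs i := Fin (Fintype.card (D.Obs (f.fN.symm i)))
  trans s a := simplexMap f.fS (D.trans (f.fS.symm s) (f.invA a))
  reward s a := D.reward (f.fS.symm s) (f.invA a)
  obsKer s a := simplexMap f.invO.symm (D.obsKer (f.fS.symm s) (f.invA a))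
  init := simplexMap f.fS D.init
  T := D.T

/-- `f⁻¹` is an isomorphism from `f^*D` to `D`. -/
def isoInv (f : Labeling D) : Iso f.relabel D where
  fN := f.fN.symm
  fS := f.fS.symm
  fA i := (f.fA (f.fN.symm i)).symm
  fO i := (f.fO (f.fN.symm i)).symm
  horizon_eq := rfl
  trans_eq _ _ _ := rfl
  obs_eq _ _ _ := rfl
  reward_eq _ _ := rfl
  init_eq _ := rfl

end Labeling

/-- The set of all relabeled Dec-POMDPs of `D`. -/
def relabeled (D : DecPOMDP.{u}) : Set DecPOMDP.{0} :=
  {E | ∃ f : Labeling D, E = f.relabel}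

instance (D : DecPOMDP.{u}) : Finite D.relabeled :=
  ((Set.finite_range (Labeling.relabel (D := D))).subset (by
    rintro E ⟨f, rfl⟩; exact ⟨f, rfl⟩)).to_subtype

instance (D : DecPOMDP.{u}) : Fintype D.relabeled := Fintype.ofFinite _

/-! ### The label-free coordination game -/

/-- Learning algorithms for a set of Dec-POMDPs. -/
abbrev LearningAlg (C : Set DecPOMDP.{u}) : Type (u + 1) :=
  (E : C) → ProbabilityMeasure E.1.Policy

/-- The common payoff `U^D(σ)` of the label-free coordination game for `D`. `𝔼` is the average over
a finite type, i.e. the expectation under the uniform distribution; independent draws by the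
principals are draws of a function of the principals. -/
def payoff (D : DecPOMDP.{u}) (σ : Fin D.N → LearningAlg D.relabeled) : ℝ :=
  𝔼 d : Fin D.N → D.relabeled, 𝔼 f : (∀ j, Iso (d j).1 D),
    ∫ π : Fin D.N → D.Policy, J (fun l => π l l)
      ∂(Measure.pi fun k => ((f k).pushDist (σ k (d k)) : Measure D.Policy))

/-! ### Policies corresponding to distributions, and the symmetrizer -/

/-- `ℙ_μ(Q)` for an event `Q ⊆ Ω`, when a joint policy is drawn from `μ` at the beginning of an
episode and then followed. -/
def mixProb {D : DecPOMDP.{u}} (μ : Measure D.Policy) (Q : Set D.Traj) : ℝ :=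
  ∑ ω : D.Traj, Q.indicator (fun ω => ∫ π, trajProb π ω ∂μ) ω

/-- The event `{AO_{i,t} = τ}`. -/
def evAO {D : DecPOMDP.{u}} (i : Fin D.N) (t : Fin (D.T + 1)) (τ : D.AOHist i t) : Set D.Traj :=
  {ω | aoHist ω i t = τ}

/-- The event `{A_{i,t} = a}`. -/
def evAct {D : DecPOMDP.{u}} (i : Fin D.N) (t : Fin (D.T + 1)) (a : D.Act i) : Set D.Traj :=
  {ω | ω.2.1 t i = a}

lemma trajProb_nonneg {D : DecPOMDP.{u}} (π : D.Policy) (ω : D.Traj) : 0 ≤ trajProb π ω :=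
  mul_nonneg (mul_nonneg (D.init.2.1 _) (Finset.prod_nonneg fun _ _ =>
    mul_nonneg ((D.trans _ _).2.1 _) ((D.obsKer _ _).2.1 _)))
    (Finset.prod_nonneg fun _ _ => Finset.prod_nonneg fun _ _ => (π _ _ _).2.1 _)

lemma mixProb_nonneg {D : DecPOMDP.{u}} (μ : Measure D.Policy) (Q : Set D.Traj) :
    0 ≤ mixProb μ Q :=
  Finset.sum_nonneg fun _ _ => Set.indicator_nonneg
    (fun _ _ => integral_nonneg fun _ => trajProb_nonneg _ _) _

lemma sum_mixProb_evAct {D : DecPOMDP.{u}} (μ : Measure D.Policy) (Q : Set D.Traj)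
    (i : Fin D.N) (t : Fin (D.T + 1)) :
    ∑ a, mixProb μ (evAct i t a ∩ Q) = mixProb μ Q := by
  classical
  unfold mixProb
  rw [Finset.sum_comm]
  refine Finset.sum_congr rfl fun ω _ => ?_
  rw [Finset.sum_eq_single (ω.2.1 t i)]
  · simp [Set.indicator, evAct]
  · intro a _ ha
    simp [Set.indicator, evAct, ha.symm]
  · simp

/-- The conditional distribution `ℙ_μ(A_{i,t} = · ∣ Q)` for an event `Q` of positive probability. -/
def condAct {D : DecPOMDP.{u}} (μ : Measure D.Policy) (Q : Set D.Traj) (hQ : 0 < mixProb μ Q)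
    (i : Fin D.N) (t : Fin (D.T + 1)) : stdSimplex ℝ (D.Act i) :=
  ⟨fun a => mixProb μ (evAct i t a ∩ Q) / mixProb μ Q,
    fun _ => div_nonneg (mixProb_nonneg _ _) (mixProb_nonneg _ _), by
      rw [← Finset.sum_div, sum_mixProb_evAct, div_self hQ.ne']⟩

lemma nonempty_act {D : DecPOMDP.{u}} {i : Fin D.N} (μ : ProbabilityMeasure (D.LocalPolicy i)) :
    Nonempty (D.Act i) := by
  obtain ⟨p⟩ := nonempty_of_isProbabilityMeasure (μ : Measure (D.LocalPolicy i))
  by_contra h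
  rw [not_nonempty_iff] at h
  have := (p 0 (fun k => k.elim0)).2.2
  simp at this

open Classical in
/-- The local policy `π_i^{μ_i}` corresponding to a distribution `μ_i` over local policies of agent
`i`: the conditional distribution of `A_{i,t}` given `AO_{i,t} = τ` under `ℙ_{μ_i ⊗ μ_{-i}}`, for any
`μ_{-i}` with independent local policies that gives the condition positive probability, and the
uniform distribution if there is no such `μ_{-i}`. Here `μ_i ⊗ μ_{-i}` is the product of a family
`ν` of distributions over the local policies of all agents with `ν i = μ_i`. -/
def localOfDist {D : DecPOMDP.{u}} (i : Fin D.N) (μi : ProbabilityMeasure (D.LocalPolicy i)) :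
    D.LocalPolicy i :=
  fun t τ =>
    if h : ∃ ν : ∀ j, ProbabilityMeasure (D.LocalPolicy j), ν i = μi ∧
        0 < mixProb (Measure.pi fun j => (ν j : Measure (D.LocalPolicy j))) (evAO i t τ) then
      condAct (Measure.pi fun j => (h.choose j : Measure (D.LocalPolicy j))) (evAO i t τ)
        h.choose_spec.2 i t
    else
      haveI := nonempty_act μi
      uniformSimplex (D.Act i)

/-- For a profile `φ` of automorphisms, the joint policy `φ^*π` in which agent `i` has the local
policy `proj_i (φ_i^* π)`. -/
def profilePush {D : DecPOMDP.{u}} (φ : Fin D.N → Aut D) (π : D.Policy) : D.Policy :=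
  fun i => (φ i).push π i

/-- The other-play distribution `|Aut(D)|^{-N} ∑_φ δ_{φ^*π}` of `π`. -/
def opDist {D : DecPOMDP.{u}} (π : D.Policy) : ProbabilityMeasure D.Policy :=
  ⟨((Fintype.card (Aut D) : ℝ≥0∞) ^ D.N)⁻¹ •
      ∑ φ : Fin D.N → Aut D, Measure.dirac (profilePush φ π), ⟨by
    have h0 : (Fintype.card (Aut D) : ℝ≥0∞) ≠ 0 := by simp
    have h1 : (Fintype.card (Aut D) : ℝ≥0∞) ≠ ⊤ := by simp
    simp only [Measure.smul_apply, Measure.finsetSum_apply, measure_univ, Finset.sum_const,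
      Finset.card_univ, Fintype.card_pi, Finset.prod_const, Fintype.card_fin, smul_eq_mul,
      nsmul_eq_mul, mul_one, Nat.cast_pow]
    exact ENNReal.inv_mul_cancel (pow_ne_zero _ h0) (ENNReal.pow_ne_top h1)⟩⟩

/-- The symmetrizer `Ψ^D`: `Ψ_i(π)` is the local policy corresponding to the `i`-th marginal of the
other-play distribution of `π`. -/
def symmetrizer {D : DecPOMDP.{u}} (π : D.Policy) : D.Policy :=
  fun i => localOfDist i ((opDist π).map (measurable_pi_apply i).aemeasurable)

/-- Equivalence of joint policies: they have the same symmetrization. -/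
def Equivalent {D : DecPOMDP.{u}} (π π' : D.Policy) : Prop :=
  symmetrizer π = symmetrizer π'

end DecPOMDP

end

/-!
Agent `i`'s part in the probability of an episode is its realization plan: the product of the
probabilities of its own actions along its own history. A local policy drawn from `μ` at the start
has as its plan the `μ`-average of the plans. By perfect recall, the posterior of the next own
action given the own history is a quotient of two values of this averaged plan, whatever the others
do, so the posteriors multiply up to the averaged plan again (Kuhn's theorem). Hence playing
`localOfDist i (μ i)` for all `i` has the same outcome as drawing local policies independently from
the `μ i`. For the other-play marginals this says that the return of the profile `Ψ_k(π^(k))` is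
the average of the returns of `((φ_k^* π^(k))_k)_k` over `φ ∈ Aut(D)^N`.

The payoff averages over `g_k ∈ Iso(D_k, D)`. As `Iso(D_k, D) = Aut(D) ∘ f_{D_k, D}`, a uniform
isomorphism is the chosen one followed by a uniform automorphism, and the average over the
automorphisms is the symmetrization.
-/

namespace DecPOMDP

noncomputable section

/-! ### Realization plans -/

section RealizationPlan

variable {D : DecPOMDP.{u}} {i : Fin D.N}

/-- A realization plan of agent `i`, in the sense of the sequence form of extensive games:
`weight t τ a` is the probability that the agent contributes the actions of the history `τ` followed
by `a`, provided that the rest of the system supplies the observations of `τ`. -/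
structure RealizationPlan (D : DecPOMDP.{u}) (i : Fin D.N) where
  weight : (t : Fin (D.T + 1)) → D.AOHist i t → D.Act i → ℝ
  nonneg : ∀ t τ a, 0 ≤ weight t τ a
  sum_zero : ∀ τ, ∑ a, weight 0 τ a = 1
  sum_succ : ∀ (t : Fin D.T) (τ : D.AOHist i t.succ),
    ∑ a, weight t.succ τ a = weight t.castSucc (Fin.init τ) (τ (Fin.last t)).1

/-- The weight that a realization plan gives to the actions of a history. -/
def RealizationPlan.histWeight (r : RealizationPlan D i) (t : Fin (D.T + 1)) (τ : D.AOHist i t) :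
    ℝ :=
  ∑ a, r.weight t τ a

lemma RealizationPlan.histWeight_nonneg (r : RealizationPlan D i) (t : Fin (D.T + 1))
    (τ : D.AOHist i t) : 0 ≤ r.histWeight t τ :=
  Finset.sum_nonneg fun a _ => r.nonneg t τ a

lemma RealizationPlan.weight_eq_zero_of_histWeight_eq_zero (r : RealizationPlan D i)
    {t : Fin (D.T + 1)} {τ : D.AOHist i t} (h : r.histWeight t τ = 0) (a : D.Act i) :
    r.weight t τ a = 0 :=
  (Finset.sum_eq_zero_iff_of_nonneg fun a _ => r.nonneg t τ a).1 h a (Finset.mem_univ a)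

namespace LocalPolicy

/-- The probability that the local policy `p` takes all actions of the history `τ`, provided that
the observations of `τ` are made. -/
def histProb (p : D.LocalPolicy i) (t : Fin (D.T + 1)) (τ : D.AOHist i t) : ℝ :=
  ∏ k : Fin t, p (k.castLE t.2.le) (fun l => τ (l.castLE k.2.le)) (τ k).1

lemma histProb_zero (p : D.LocalPolicy i) (τ : D.AOHist i (0 : Fin (D.T + 1))) :
    histProb p 0 τ = 1 :=
  Fin.prod_univ_zero _

lemma histProb_succ (p : D.LocalPolicy i) (t : Fin D.T) (τ : D.AOHist i t.succ) :
    histProb p t.succ τ =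
      histProb p t.castSucc (Fin.init τ) * p t.castSucc (Fin.init τ) (τ (Fin.last t)).1 :=
  Fin.prod_univ_castSucc (n := t) _

lemma histProb_nonneg (p : D.LocalPolicy i) (t : Fin (D.T + 1)) (τ : D.AOHist i t) :
    0 ≤ histProb p t τ :=
  Finset.prod_nonneg fun _ _ => (p _ _).2.1 _

lemma histProb_le_one (p : D.LocalPolicy i) (t : Fin (D.T + 1)) (τ : D.AOHist i t) :
    histProb p t τ ≤ 1 :=
  Finset.prod_le_one (fun _ _ => (p _ _).2.1 _) fun _ _ => stdSimplex.le_one _ _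

/-- The realization plan of a local policy. -/
@[simps weight]
def toPlan (p : D.LocalPolicy i) : RealizationPlan D i where
  weight t τ a := histProb p t τ * p t τ a
  nonneg t τ a := mul_nonneg (histProb_nonneg p t τ) ((p t τ).2.1 a)
  sum_zero τ := by rw [← Finset.mul_sum, histProb_zero, one_mul]; exact (p 0 τ).2.2
  sum_succ t τ := by
    rw [← Finset.mul_sum, ← histProb_succ]
    exact (congrArg _ (p t.succ τ).2.2).trans (mul_one _)

lemma toPlan_weight_mem_Icc (p : D.LocalPolicy i) (t : Fin (D.T + 1)) (τ : D.AOHist i t)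
    (a : D.Act i) : (toPlan p).weight t τ a ∈ Set.Icc 0 1 :=
  ⟨(toPlan p).nonneg t τ a, mul_le_one₀ (histProb_le_one p t τ) ((p t τ).2.1 a)
    (stdSimplex.le_one _ _)⟩

lemma measurable_toPlan_weight (t : Fin (D.T + 1)) (τ : D.AOHist i t) (a : D.Act i) :
    Measurable fun p : D.LocalPolicy i => (toPlan p).weight t τ a := by
  have measurable_apply : ∀ (t : Fin (D.T + 1)) (τ : D.AOHist i t) (a : D.Act i),
      Measurable fun p : D.LocalPolicy i => p t τ a := fun t τ a =>
    (measurable_pi_apply a).comp (measurable_subtype_coe.comp (by fun_prop))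
  exact (Finset.measurable_fun_prod _ fun _ _ => measurable_apply _ _ _).mul
    (measurable_apply t τ a)

lemma integrable_toPlan_weight (μ : Measure (D.LocalPolicy i)) [IsFiniteMeasure μ]
    (t : Fin (D.T + 1)) (τ : D.AOHist i t) (a : D.Act i) :
    Integrable (fun p => (toPlan p).weight t τ a) μ :=
  .of_mem_Icc 0 1 (measurable_toPlan_weight t τ a).aemeasurable
    (.of_forall fun p => toPlan_weight_mem_Icc p t τ a)

/-- The realization plan of an agent who draws a local policy from `μ` and then follows it. -/
@[simps weight]
def mixPlan (μ : ProbabilityMeasure (D.LocalPolicy i)) : RealizationPlan D i where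
  weight t τ a := ∫ p, (toPlan p).weight t τ a ∂(μ : Measure (D.LocalPolicy i))
  nonneg t τ a := integral_nonneg fun p => (toPlan p).nonneg t τ a
  sum_zero τ := by
    rw [← integral_finsetSum _ fun a _ => integrable_toPlan_weight _ _ τ a]
    simp only [(toPlan _).sum_zero, integral_const, probReal_univ, smul_eq_mul, mul_one]
  sum_succ t τ := by
    rw [← integral_finsetSum _ fun a _ => integrable_toPlan_weight _ _ τ a]
    simp only [(toPlan _).sum_succ]

/-- **Kuhn's theorem** along a single episode. -/
lemma toPlan_weight_eq_of_mul_histWeight (p : D.LocalPolicy i) (r : RealizationPlan D i)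
    (ω : D.Traj) (h : ∀ t a, p t (aoHist ω i t) a * r.histWeight t (aoHist ω i t) =
      r.weight t (aoHist ω i t) a) (t : Fin (D.T + 1)) (a : D.Act i) :
    (toPlan p).weight t (aoHist ω i t) a = r.weight t (aoHist ω i t) a := by
  have histProb_eq : histProb p t (aoHist ω i t) = r.histWeight t (aoHist ω i t) := by
    induction t using Fin.induction with
    | zero => rw [histProb_zero]; exact (r.sum_zero _).symm
    | succ t ih =>
      rw [histProb_succ]
      refine Eq.trans ?_ (r.sum_succ t _).symm
      exact (congrArg (· * _) ih).trans ((mul_comm _ _).trans (h t.castSucc (ω.2.1 t.castSucc i)))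
  rw [toPlan_weight, histProb_eq, mul_comm, h]

end LocalPolicy

end RealizationPlan

/-! ### Episodes and their prefixes -/

section Prefix

variable {D : DecPOMDP.{u}}

/-- The prefixes of episodes that end with the state at time `n`. As in `Traj`, entry `k` of the
last component is the joint observation at time `k + 1`. -/
abbrev Prefix (D : DecPOMDP.{u}) (n : ℕ) : Type u :=
  (Fin (n + 1) → D.State) × (Fin n → D.JAct) × (Fin n → D.JObs)

namespace Prefix

variable {n : ℕ}

/-- The action-observation history of agent `i` in a prefix. -/
def hist (x : D.Prefix n) (i : Fin D.N) : D.AOHist i n :=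
  fun k => (x.2.1 k i, x.2.2 k i)

/-- The probability that the environment supplies the states and observations of a prefix if the
agents take its actions. -/
def envProb (x : D.Prefix n) : ℝ :=
  D.init (x.1 0) * ∏ t : Fin n, D.trans (x.1 t.castSucc) (x.2.1 t) (x.1 t.succ) *
    D.obsKer (x.1 t.succ) (x.2.1 t) (x.2.2 t)

lemma envProb_nonneg (x : D.Prefix n) : 0 ≤ x.envProb :=
  mul_nonneg (D.init.2.1 _) <| Finset.prod_nonneg fun _ _ =>
    mul_nonneg ((D.trans _ _).2.1 _) ((D.obsKer _ _).2.1 _)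

lemma envProb_le_one (x : D.Prefix n) : x.envProb ≤ 1 :=
  mul_le_one₀ (stdSimplex.le_one _ _)
    (Finset.prod_nonneg fun _ _ => mul_nonneg ((D.trans _ _).2.1 _) ((D.obsKer _ _).2.1 _)) <|
    Finset.prod_le_one (fun _ _ => mul_nonneg ((D.trans _ _).2.1 _) ((D.obsKer _ _).2.1 _))
      fun _ _ => mul_le_one₀ (stdSimplex.le_one _ _) ((D.obsKer _ _).2.1 _) (stdSimplex.le_one _ _)

/-- Extension of a prefix by a joint action, the next state and a joint observation. -/
def snoc (x : D.Prefix n) (a : D.JAct) (s : D.State) (o : D.JObs) : D.Prefix (n + 1) :=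
  (Fin.snoc x.1 s, Fin.snoc x.2.1 a, Fin.snoc x.2.2 o)

/-- The prefix up to the preceding time step. -/
def init (x : D.Prefix (n + 1)) : D.Prefix n :=
  (Fin.init x.1, Fin.init x.2.1, Fin.init x.2.2)

lemma init_snoc (x : D.Prefix n) (a : D.JAct) (s : D.State) (o : D.JObs) :
    (x.snoc a s o).init = x := by
  simp only [init, snoc, Fin.init_snoc]

lemma snoc_init_self (x : D.Prefix (n + 1)) :
    x.init.snoc (x.2.1 (Fin.last n)) (x.1 (Fin.last (n + 1))) (x.2.2 (Fin.last n)) = x := by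
  simp only [init, snoc, Fin.snoc_init_self]

lemma hist_snoc (x : D.Prefix n) (a : D.JAct) (s : D.State) (o : D.JObs) (i : Fin D.N) :
    (x.snoc a s o).hist i = Fin.snoc (x.hist i) (a i, o i) := by
  funext k
  refine Fin.lastCases ?_ (fun k => ?_) k <;> simp [hist, snoc]

lemma envProb_snoc (x : D.Prefix n) (a : D.JAct) (s : D.State) (o : D.JObs) :
    (x.snoc a s o).envProb =
      x.envProb * (D.trans (x.1 (Fin.last n)) a s * D.obsKer s a o) := by
  have snoc_zero : (Fin.snoc x.1 s : Fin (n + 2) → D.State) 0 = x.1 0 :=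
    Fin.snoc_castSucc (α := fun _ => D.State) s x.1 0
  simp only [envProb, snoc, Fin.prod_univ_castSucc, Fin.snoc_castSucc, Fin.snoc_last, snoc_zero,
    ← Fin.castSucc_succ, Fin.succ_last, mul_assoc]

lemma sum_eq_sum_snoc (F : D.Prefix (n + 1) → ℝ) :
    ∑ x, F x = ∑ x : D.Prefix n, ∑ a, ∑ s, ∑ o, F (x.snoc a s o) := by
  let e : D.Prefix n × D.JAct × D.State × D.JObs ≃ D.Prefix (n + 1) :=
    { toFun := fun p => snoc p.1 p.2.1 p.2.2.1 p.2.2.2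
      invFun := fun x => (x.init, x.2.1 (Fin.last n), x.1 (Fin.last (n + 1)), x.2.2 (Fin.last n))
      left_inv := fun p => Prod.ext (init_snoc _ _ _ _) (by simp only [snoc, Fin.snoc_last])
      right_inv := snoc_init_self }
  simp only [← e.sum_comp F, Fintype.sum_prod_type]
  rfl

end Prefix

/-- The prefix of the episode `ω` up to time `n`. -/
def trajPrefix (ω : D.Traj) (n : Fin (D.T + 1)) : D.Prefix n :=
  (fun k => ω.1 (k.castLE n.2), fun k => ω.2.1 (k.castLE n.2.le),
    fun k => ω.2.2 (k.castLE (Nat.le_of_lt_succ n.2)))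

lemma hist_trajPrefix (ω : D.Traj) (n : Fin (D.T + 1)) (i : Fin D.N) :
    (trajPrefix ω n).hist i = aoHist ω i n :=
  rfl

lemma envProb_trajPrefix_ne_zero {ω : D.Traj} (h : (trajPrefix ω (Fin.last D.T)).envProb ≠ 0)
    (n : Fin (D.T + 1)) : (trajPrefix ω n).envProb ≠ 0 := by
  simp only [Prefix.envProb, mul_ne_zero_iff, Finset.prod_ne_zero_iff, Finset.mem_univ,
    true_imp_iff] at h ⊢
  exact ⟨h.1, fun k => h.2 (k.castLE (Nat.le_of_lt_succ n.2))⟩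

lemma sum_traj_eq_sum_prefix (F : D.Prefix D.T → D.JAct → ℝ) :
    ∑ ω : D.Traj, F (trajPrefix ω (Fin.last D.T)) (ω.2.1 (Fin.last D.T)) = ∑ x, ∑ a, F x a := by
  let e : D.Traj ≃ D.Prefix D.T × D.JAct :=
    { toFun := fun ω => (trajPrefix ω (Fin.last D.T), ω.2.1 (Fin.last D.T))
      invFun := fun p => (p.1.1, Fin.snoc p.1.2.1 p.2, p.1.2.2)
      left_inv := fun ω => Prod.ext rfl (Prod.ext (Fin.snoc_init_self ω.2.1) rfl)
      right_inv := fun p => Prod.ext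
        (Prod.ext rfl (Prod.ext (Fin.init_snoc (α := fun _ => D.JAct) _ _) rfl))
        (Fin.snoc_last (α := fun _ => D.JAct) _ _) }
  rw [← Fintype.sum_prod_type']
  exact e.sum_comp fun p => F p.1 p.2

/-- The probability of the prefix `x` followed by the joint action `a` under a profile of
realization plans. -/
def prefixProb (r : ∀ i, RealizationPlan D i) (n : Fin (D.T + 1)) (x : D.Prefix n)
    (a : D.JAct) : ℝ :=
  x.envProb * ∏ i, (r i).weight n (x.hist i) (a i)

lemma trajProb_eq_prefixProb (π : D.Policy) (ω : D.Traj) :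
    trajProb π ω = prefixProb (fun i => (π i).toPlan) (Fin.last D.T) (trajPrefix ω (Fin.last D.T))
      (ω.2.1 (Fin.last D.T)) := by
  unfold trajProb
  rw [Finset.prod_comm]
  refine congrArg _ (Finset.prod_congr rfl fun i _ => ?_)
  exact Fin.prod_univ_castSucc _

lemma trajProb_mem_Icc (π : D.Policy) (ω : D.Traj) : trajProb π ω ∈ Set.Icc 0 1 := by
  refine ⟨trajProb_nonneg π ω, ?_⟩
  rw [trajProb_eq_prefixProb]
  exact mul_le_one₀ (Prefix.envProb_le_one _)
    (Finset.prod_nonneg fun i _ => (π i).toPlan.nonneg _ _ _)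
    (Finset.prod_le_one (fun i _ => (π i).toPlan.nonneg _ _ _)
      fun i _ => ((π i).toPlan_weight_mem_Icc _ _ _).2)

lemma measurable_trajProb (ω : D.Traj) : Measurable fun π : D.Policy => trajProb π ω := by
  simp only [trajProb_eq_prefixProb]
  exact (Finset.measurable_fun_prod _ fun i _ =>
    (LocalPolicy.measurable_toPlan_weight _ _ _).comp (measurable_pi_apply i)).const_mul _

lemma sum_prefixProb_snoc (r : ∀ i, RealizationPlan D i) (t : Fin D.T) (x : D.Prefix t)
    (a : D.JAct) :
    ∑ s, ∑ o, ∑ b, prefixProb r t.succ (x.snoc a s o) b = prefixProb r t.castSucc x a := by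
  have sum_weight : ∀ s o, ∑ b : D.JAct, ∏ i, (r i).weight t.succ ((x.snoc a s o).hist i) (b i) =
      ∏ i, (r i).weight t.castSucc (x.hist i) (a i) := fun s o => by
    rw [← Fintype.prod_sum]
    refine Finset.prod_congr rfl fun i _ => ?_
    rw [Prefix.hist_snoc, (r i).sum_succ, Fin.init_snoc, Fin.snoc_last]
  have sum_obsKer : ∀ s, ∑ o, D.obsKer s a o = 1 := fun s => (D.obsKer s a).2.2
  have sum_trans : ∑ s, D.trans (x.1 (Fin.last t)) a s = 1 := (D.trans _ a).2.2
  simp only [prefixProb, ← Finset.mul_sum, sum_weight, Prefix.envProb_snoc, ← Finset.sum_mul,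
    sum_obsKer, mul_one, sum_trans]

/-- The weights of the continuations after time `n` sum to one. -/
lemma sum_prefixProb_trajPrefix_mul (r : ∀ i, RealizationPlan D i) (n : Fin (D.T + 1))
    (g : D.Prefix n → D.JAct → ℝ) :
    ∑ ω : D.Traj, prefixProb r (Fin.last D.T) (trajPrefix ω (Fin.last D.T)) (ω.2.1 (Fin.last D.T)) *
      g (trajPrefix ω n) (ω.2.1 n) = ∑ x, ∑ a, prefixProb r n x a * g x a := by
  induction n using Fin.reverseInduction with
  | last => exact sum_traj_eq_sum_prefix fun x a => prefixProb r (Fin.last D.T) x a * g x a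
  | cast t ih =>
    refine (ih fun (y : D.Prefix (t + 1)) _ => g y.init (y.2.1 (Fin.last t))).trans ?_
    refine (Prefix.sum_eq_sum_snoc _).trans ?_
    refine Finset.sum_congr rfl fun x _ => Finset.sum_congr rfl fun a _ => ?_
    have last_snoc : ∀ s o, (x.snoc a s o).2.1 (Fin.last t) = a := fun _ _ =>
      Fin.snoc_last (α := fun _ => D.JAct) _ _
    simp only [Prefix.init_snoc, last_snoc, ← Finset.sum_mul]
    rw [sum_prefixProb_snoc]

end Prefix

/-! ### Conditioning on a history -/

section Conditioning

variable {D : DecPOMDP.{u}} {i : Fin D.N}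

lemma sum_filter_eval_prod {ι : Type*} [Fintype ι] [DecidableEq ι] {X : ι → Type*}
    [∀ i, Fintype (X i)] [∀ i, DecidableEq (X i)] {R : Type*} [CommSemiring R] (f : ∀ i, X i → R)
    (i : ι) (a : X i) :
    ∑ b : ∀ i, X i with b i = a, ∏ j, f j (b j) =
      f i a * ∏ j ∈ Finset.univ.erase i, ∑ x, f j x := by
  rw [← Fintype.piFinset_univ,
    ← Fintype.piFinset_update_singleton_eq_filter_piFinset_eq _ i (Finset.mem_univ a),
    ← Finset.prod_univ_sum, ← Finset.mul_prod_erase _ _ (Finset.mem_univ i)]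
  congr 1
  · simp
  · exact Finset.prod_congr rfl fun j hj => by
      rw [Function.update_of_ne (Finset.ne_of_mem_erase hj)]

open Classical in
/-- The probability that the environment and the agents other than `i` contribute their part to the
event that agent `i` observes the history `τ`. -/
def othersReach (r : ∀ j, RealizationPlan D j) (i : Fin D.N) (t : Fin (D.T + 1))
    (τ : D.AOHist i t) : ℝ :=
  ∑ x : D.Prefix t with x.hist i = τ,
    x.envProb * ∏ j ∈ Finset.univ.erase i, (r j).histWeight t (x.hist j)

lemma othersReach_pos (r : ∀ j, RealizationPlan D j) {t : Fin (D.T + 1)} {ω : D.Traj}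
    (henv : (trajPrefix ω t).envProb ≠ 0)
    (hr : ∀ j ≠ i, 0 < (r j).histWeight t (aoHist ω j t)) :
    0 < othersReach r i t (aoHist ω i t) :=
  Finset.sum_pos'
    (fun x _ => mul_nonneg x.envProb_nonneg
      (Finset.prod_nonneg fun j _ => (r j).histWeight_nonneg _ _))
    ⟨trajPrefix ω t, by simp [hist_trajPrefix], mul_pos (henv.lt_of_le' (Prefix.envProb_nonneg _))
      (Finset.prod_pos fun j hj => hr j (Finset.ne_of_mem_erase hj))⟩

open Classical in
lemma sum_prefixProb_filter (r : ∀ j, RealizationPlan D j) (t : Fin (D.T + 1)) (τ : D.AOHist i t)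
    (a : D.Act i) :
    ∑ x : D.Prefix t with x.hist i = τ, ∑ b : D.JAct with b i = a, prefixProb r t x b =
      (r i).weight t τ a * othersReach r i t τ := by
  rw [othersReach, Finset.mul_sum]
  refine Finset.sum_congr rfl fun x hx => ?_
  simp only [prefixProb, ← Finset.mul_sum]
  rw [sum_filter_eval_prod fun j => (r j).weight t (x.hist j), (Finset.mem_filter.1 hx).2]
  exact mul_left_comm _ _ _

lemma integral_trajProb_pi (ν : ∀ i, ProbabilityMeasure (D.LocalPolicy i)) (ω : D.Traj) :
    ∫ π, trajProb π ω ∂(Measure.pi fun i => (ν i : Measure (D.LocalPolicy i))) =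
      prefixProb (fun i => LocalPolicy.mixPlan (ν i)) (Fin.last D.T)
        (trajPrefix ω (Fin.last D.T)) (ω.2.1 (Fin.last D.T)) := by
  simp only [trajProb_eq_prefixProb, prefixProb]
  rw [integral_const_mul, integral_fintype_prod_eq_prod (𝕜 := ℝ) fun i (p : D.LocalPolicy i) =>
    p.toPlan.weight _ _ (ω.2.1 (Fin.last D.T) i)]
  rfl

lemma mixProb_evAct_inter_evAO (ν : ∀ j, ProbabilityMeasure (D.LocalPolicy j)) (t : Fin (D.T + 1))
    (τ : D.AOHist i t) (a : D.Act i) :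
    mixProb (Measure.pi fun j => (ν j : Measure (D.LocalPolicy j))) (evAct i t a ∩ evAO i t τ) =
      (LocalPolicy.mixPlan (ν i)).weight t τ a *
        othersReach (fun j => LocalPolicy.mixPlan (ν j)) i t τ := by
  classical
  rw [← sum_prefixProb_filter fun j => LocalPolicy.mixPlan (ν j)]
  have marginal := sum_prefixProb_trajPrefix_mul (fun j => LocalPolicy.mixPlan (ν j)) t
    fun x b => if b i = a ∧ x.hist i = τ then 1 else 0
  simp only [mul_ite, mul_one, mul_zero] at marginal
  simp only [Finset.sum_filter, mixProb, integral_trajProb_pi, Set.indicator_apply]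
  refine Eq.trans (Finset.sum_congr rfl fun ω _ => ?_)
    (marginal.trans (Finset.sum_congr rfl fun x _ => ?_))
  · exact ite_congr rfl (fun _ => rfl) fun _ => rfl
  · split_ifs with hx <;> simp only [hx, and_true, and_false, if_false, Finset.sum_const_zero]

lemma mixProb_evAO (ν : ∀ j, ProbabilityMeasure (D.LocalPolicy j)) (t : Fin (D.T + 1))
    (τ : D.AOHist i t) :
    mixProb (Measure.pi fun j => (ν j : Measure (D.LocalPolicy j))) (evAO i t τ) =
      (LocalPolicy.mixPlan (ν i)).histWeight t τ *
        othersReach (fun j => LocalPolicy.mixPlan (ν j)) i t τ := by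
  rw [← sum_mixProb_evAct _ _ i t]
  simp only [mixProb_evAct_inter_evAO, ← Finset.sum_mul]
  rfl

/-- The posterior of agent `i`'s next action does not depend on how the other agents behave. -/
lemma condAct_mul_histWeight {ν : ∀ j, ProbabilityMeasure (D.LocalPolicy j)}
    {μ : ProbabilityMeasure (D.LocalPolicy i)} (hν : ν i = μ) {t : Fin (D.T + 1)}
    {τ : D.AOHist i t}
    (h : 0 < mixProb (Measure.pi fun j => (ν j : Measure (D.LocalPolicy j))) (evAO i t τ))
    (a : D.Act i) :
    condAct _ _ h i t a * (LocalPolicy.mixPlan μ).histWeight t τ =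
      (LocalPolicy.mixPlan μ).weight t τ a := by
  subst hν
  change mixProb _ (evAct i t a ∩ evAO i t τ) / mixProb _ (evAO i t τ) * _ = _
  rw [mixProb_evAO] at h ⊢
  obtain ⟨hist_ne, others_ne⟩ := mul_ne_zero_iff.1 h.ne'
  rw [mixProb_evAct_inter_evAO]
  field_simp

lemma LocalPolicy.mixPlan_diracProba_weight (p : D.LocalPolicy i) (t : Fin (D.T + 1))
    (τ : D.AOHist i t) (a : D.Act i) :
    (mixPlan (diracProba p)).weight t τ a = p.toPlan.weight t τ a :=
  integral_dirac' _ _ (measurable_toPlan_weight t τ a).stronglyMeasurable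

lemma LocalPolicy.histWeight_mixPlan_diracProba_pos [Nonempty (D.Act i)] {p : D.LocalPolicy i}
    (hp : ∀ t τ a, 0 < p t τ a) (t : Fin (D.T + 1)) (τ : D.AOHist i t) :
    0 < (mixPlan (diracProba p)).histWeight t τ :=
  Finset.sum_pos (fun a _ => by
    rw [mixPlan_diracProba_weight]
    exact mul_pos (Finset.prod_pos fun _ _ => hp _ _ _) (hp t τ a)) Finset.univ_nonempty

lemma uniformSimplex_pos {X : Type*} [Fintype X] [Nonempty X] (x : X) : 0 < uniformSimplex X x :=
  one_div_pos.2 (Nat.cast_pos.2 Fintype.card_pos)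

/-- The other agents may be assumed to play uniformly at random. -/
lemma exists_mixProb_evAO_pos (μ : ProbabilityMeasure (D.LocalPolicy i)) {t : Fin (D.T + 1)}
    {ω : D.Traj} (henv : (trajPrefix ω t).envProb ≠ 0)
    (hμ : (LocalPolicy.mixPlan μ).histWeight t (aoHist ω i t) ≠ 0) :
    ∃ ν : ∀ j, ProbabilityMeasure (D.LocalPolicy j), ν i = μ ∧
      0 < mixProb (Measure.pi fun j => (ν j : Measure (D.LocalPolicy j)))
        (evAO i t (aoHist ω i t)) := by
  have : ∀ j, Nonempty (D.Act j) := fun j => ⟨ω.2.1 t j⟩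
  let uniform : ∀ j, ProbabilityMeasure (D.LocalPolicy j) := fun j =>
    diracProba fun _ _ => uniformSimplex (D.Act j)
  refine ⟨Function.update uniform i μ, Function.update_self i μ uniform, ?_⟩
  rw [mixProb_evAO]
  refine mul_pos ?_ (othersReach_pos _ henv fun j hj => ?_)
  · rw [Function.update_self]
    exact hμ.lt_of_le' (RealizationPlan.histWeight_nonneg _ _ _)
  · simp only [Function.update_of_ne hj]
    exact LocalPolicy.histWeight_mixPlan_diracProba_pos (fun _ _ => uniformSimplex_pos) t _

lemma localOfDist_mul_histWeight (μ : ProbabilityMeasure (D.LocalPolicy i)) {t : Fin (D.T + 1)}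
    {ω : D.Traj} (henv : (trajPrefix ω t).envProb ≠ 0) (a : D.Act i) :
    localOfDist i μ t (aoHist ω i t) a * (LocalPolicy.mixPlan μ).histWeight t (aoHist ω i t) =
      (LocalPolicy.mixPlan μ).weight t (aoHist ω i t) a := by
  by_cases hμ : (LocalPolicy.mixPlan μ).histWeight t (aoHist ω i t) = 0
  · rw [hμ, mul_zero, RealizationPlan.weight_eq_zero_of_histWeight_eq_zero _ hμ]
  · have hex := exists_mixProb_evAO_pos μ henv hμ
    rw [localOfDist, dif_pos hex]
    exact condAct_mul_histWeight hex.choose_spec.1 hex.choose_spec.2 a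

lemma trajProb_localOfDist (μ : ∀ i, ProbabilityMeasure (D.LocalPolicy i)) (ω : D.Traj) :
    trajProb (fun i => localOfDist i (μ i)) ω =
      ∫ π, trajProb π ω ∂(Measure.pi fun i => (μ i : Measure (D.LocalPolicy i))) := by
  rw [integral_trajProb_pi, trajProb_eq_prefixProb, prefixProb, prefixProb]
  by_cases henv : (trajPrefix ω (Fin.last D.T)).envProb = 0
  · rw [henv, zero_mul, zero_mul]
  · exact congrArg _ <| Finset.prod_congr rfl fun i _ =>
      LocalPolicy.toPlan_weight_eq_of_mul_histWeight _ _ ω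
        (fun t a => localOfDist_mul_histWeight (μ i) (envProb_trajPrefix_ne_zero henv t) a) _ _

end Conditioning

/-! ### The symmetrizer -/

section Symmetrizer

variable {D : DecPOMDP.{u}}

lemma prod_expect {ι : Type*} [Fintype ι] [DecidableEq ι] {X : ι → Type*} [∀ i, Fintype (X i)]
    {K : Type*} [Semifield K] [CharZero K] (F : ∀ i, X i → K) :
    ∏ i, 𝔼 x, F i x = 𝔼 φ : ∀ i, X i, ∏ i, F i (φ i) := by
  simp only [Fintype.expect_eq_sum_div_card, Finset.prod_div_distrib, Fintype.prod_sum,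
    Fintype.card_pi, Nat.cast_prod]

lemma expect_eval {ι : Type*} [Fintype ι] [DecidableEq ι] {X : ι → Type*} [∀ i, Fintype (X i)]
    [∀ i, Nonempty (X i)] {K : Type*} [Semifield K] [CharZero K] (i : ι) (F : X i → K) :
    𝔼 φ : ∀ i, X i, F (φ i) = 𝔼 x, F x := by
  have h := prod_expect (Function.update (fun j (_ : X j) => (1 : K)) i F)
  rw [← Finset.mul_prod_erase _ _ (Finset.mem_univ i), Function.update_self,
    Finset.prod_eq_one fun j hj => by
      rw [Function.update_of_ne (Finset.ne_of_mem_erase hj), Fintype.expect_const], mul_one] at h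
  rw [h]
  refine Finset.expect_congr rfl fun φ _ => ?_
  rw [← Finset.mul_prod_erase _ _ (Finset.mem_univ i), Function.update_self,
    Finset.prod_eq_one fun j hj => by
      rw [Function.update_of_ne (Finset.ne_of_mem_erase hj)], mul_one]

lemma integral_opDist (π : D.Policy) {F : D.Policy → ℝ} (hF : Measurable F) :
    ∫ p, F p ∂(opDist π : Measure D.Policy) = 𝔼 φ : Fin D.N → Aut D, F (profilePush φ π) := by
  change ∫ p, F p ∂(((Fintype.card (Aut D) : ℝ≥0∞) ^ D.N)⁻¹ •
      ∑ φ : Fin D.N → Aut D, Measure.dirac (profilePush φ π)) = _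
  rw [integral_smul_measure, integral_finsetSum_measure fun φ _ =>
    integrable_dirac' hF.stronglyMeasurable (by simp)]
  simp only [integral_dirac' F _ hF.stronglyMeasurable]
  simp [Fintype.expect_eq_sum_div_card, div_eq_inv_mul]

lemma mixPlan_map_eval_opDist_weight (π : D.Policy) (i : Fin D.N) (t : Fin (D.T + 1))
    (τ : D.AOHist i t) (a : D.Act i) :
    (LocalPolicy.mixPlan ((opDist π).map (measurable_pi_apply i).aemeasurable)).weight t τ a =
      𝔼 g : Aut D, (g.push π i).toPlan.weight t τ a := by
  have measurable_weight := LocalPolicy.measurable_toPlan_weight t τ a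
  rw [LocalPolicy.mixPlan_weight, ProbabilityMeasure.toMeasure_map,
    integral_map (measurable_pi_apply i).aemeasurable measurable_weight.aestronglyMeasurable]
  exact (integral_opDist π (measurable_weight.comp (measurable_pi_apply i))).trans
    (expect_eval (X := fun _ => Aut D) i fun g => (g.push π i).toPlan.weight t τ a)

lemma trajProb_symmetrizer (π : Fin D.N → D.Policy) (ω : D.Traj) :
    trajProb (fun k => symmetrizer (π k) k) ω =
      𝔼 φ : Fin D.N → Aut D, trajProb (fun k => (φ k).push (π k) k) ω := by
  unfold symmetrizer
  rw [trajProb_localOfDist, integral_trajProb_pi]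
  simp only [trajProb_eq_prefixProb, prefixProb, mixPlan_map_eval_opDist_weight, prod_expect,
    Finset.mul_expect]

lemma J_symmetrizer (π : Fin D.N → D.Policy) :
    J (fun k => symmetrizer (π k) k) =
      𝔼 φ : Fin D.N → Aut D, J (fun k => (φ k).push (π k) k) := by
  simp only [J, trajProb_symmetrizer, Finset.expect_mul]
  exact (Finset.expect_sum_comm _ _ _).symm

end Symmetrizer

/-! ### Composition of isomorphisms -/

section Family

variable {α β γ : Type*} {W : α → Type u} {Z : β → Type v} {V : γ → Type w}

lemma piCongr_trans (e : α ≃ β) (g : ∀ i, W i ≃ Z (e i)) (e' : β ≃ γ) (g' : ∀ j, Z j ≃ V (e' j)) :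
    Equiv.piCongr (Z := V) (e.trans e') (fun i => (g i).trans (g' (e i))) =
      (Equiv.piCongr e g).trans (Equiv.piCongr e' g') :=
  Equiv.symm_bijective.injective (Equiv.ext fun _ => rfl)

/-- The family of bijections over `e.symm` which is inverse to a family `g` of bijections over `e`.
The cast is needed because `e (e.symm j)` and `j` are not definitionally equal. -/
def symmFamily (e : α ≃ β) (g : ∀ i, W i ≃ Z (e i)) (j : β) : Z j ≃ W (e.symm j) :=
  (Equiv.cast (congrArg Z (e.apply_symm_apply j).symm)).trans (g (e.symm j)).symm

lemma sigmaCongr_symmFamily (e : α ≃ β) (g : ∀ i, W i ≃ Z (e i)) :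
    Equiv.sigmaCongr e.symm (symmFamily e g) = (Equiv.sigmaCongr e g).symm := by
  refine Equiv.ext fun z => (Equiv.eq_symm_apply _).2 ?_
  obtain ⟨j, z⟩ := z
  refine Sigma.ext (e.apply_symm_apply j) ?_
  exact (heq_of_eq ((g (e.symm j)).apply_symm_apply _)).trans (cast_heq _ _)

lemma piCongr_symmFamily (e : α ≃ β) (g : ∀ i, W i ≃ Z (e i)) :
    Equiv.piCongr e.symm (symmFamily e g) = (Equiv.piCongr e g).symm := by
  refine Equiv.symm_bijective.injective (Equiv.ext fun x => funext fun j => ?_)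
  obtain ⟨i, rfl⟩ := e.surjective j
  refine Eq.trans (eq_of_heq ((cast_heq _ _).trans ?_)) (Equiv.piCongr_apply_apply e g x i).symm
  exact congr_arg_heq (fun k => g k (x k)) (e.symm_apply_apply i)

lemma eq_of_sigmaCongr_eq {e : α ≃ β} {g g' : ∀ i, W i ≃ Z (e i)}
    (h : Equiv.sigmaCongr e g = Equiv.sigmaCongr e g') : g = g' :=
  funext fun i => Equiv.ext fun x =>
    eq_of_heq (Sigma.mk.inj (Equiv.congr_fun h ⟨i, x⟩)).2

end Family

namespace Iso

variable {D : DecPOMDP.{u}} {E : DecPOMDP.{v}} {G : DecPOMDP.{w}}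

/-- The bijection which `f` induces on the pairs of an agent and one of its actions. Isomorphisms
are compared through it because the types of `f.fA` and `g.fA` depend on `f.fN` and `g.fN`. -/
def actEquiv (f : Iso D E) : (Σ i, D.Act i) ≃ Σ j, E.Act j :=
  Equiv.sigmaCongr f.fN f.fA

/-- The analogue of `actEquiv` for observations. -/
def obsEquiv (f : Iso D E) : (Σ i, D.Obs i) ≃ Σ j, E.Obs j :=
  Equiv.sigmaCongr f.fN f.fO

lemma ext_of_actEquiv {f g : Iso D E} (hN : f.fN = g.fN) (hS : f.fS = g.fS)
    (hA : f.actEquiv = g.actEquiv) (hO : f.obsEquiv = g.obsEquiv) : f = g := by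
  obtain ⟨fN, fS, fA, fO⟩ := f
  obtain ⟨gN, gS, gA, gO⟩ := g
  obtain rfl : fN = gN := hN
  obtain rfl : fS = gS := hS
  obtain rfl : fA = gA := eq_of_sigmaCongr_eq hA
  obtain rfl : fO = gO := eq_of_sigmaCongr_eq hO
  rfl

/-- Composition of isomorphisms. -/
def trans (f : Iso D E) (g : Iso E G) : Iso D G where
  fN := f.fN.trans g.fN
  fS := f.fS.trans g.fS
  fA i := (f.fA i).trans (g.fA (f.fN i))
  fO i := (f.fO i).trans (g.fO (f.fN i))
  horizon_eq := f.horizon_eq.trans g.horizon_eq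
  trans_eq s a s' := by rw [piCongr_trans, f.trans_eq, g.trans_eq]; rfl
  obs_eq s a o := by rw [piCongr_trans, piCongr_trans, f.obs_eq, g.obs_eq]; rfl
  reward_eq s a := by rw [piCongr_trans, f.reward_eq, g.reward_eq]; rfl
  init_eq s := by rw [f.init_eq, g.init_eq]; rfl

/-- The inverse isomorphism. -/
def symm (f : Iso D E) : Iso E D where
  fN := f.fN.symm
  fS := f.fS.symm
  fA := symmFamily f.fN f.fA
  fO := symmFamily f.fN f.fO
  horizon_eq := f.horizon_eq.symm
  trans_eq s a s' := by
    simp only [piCongr_symmFamily, f.trans_eq, Equiv.apply_symm_apply]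
  obs_eq s a o := by
    simp only [piCongr_symmFamily, f.obs_eq, Equiv.apply_symm_apply]
  reward_eq s a := by
    simp only [piCongr_symmFamily, f.reward_eq, Equiv.apply_symm_apply]
  init_eq s := by
    simp only [f.init_eq, Equiv.apply_symm_apply]

lemma actEquiv_trans (f : Iso D E) (g : Iso E G) :
    (f.trans g).actEquiv = f.actEquiv.trans g.actEquiv :=
  Equiv.ext fun _ => rfl

lemma obsEquiv_trans (f : Iso D E) (g : Iso E G) :
    (f.trans g).obsEquiv = f.obsEquiv.trans g.obsEquiv :=
  Equiv.ext fun _ => rfl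

lemma actEquiv_symm (f : Iso D E) : f.symm.actEquiv = f.actEquiv.symm :=
  sigmaCongr_symmFamily f.fN f.fA

lemma obsEquiv_symm (f : Iso D E) : f.symm.obsEquiv = f.obsEquiv.symm :=
  sigmaCongr_symmFamily f.fN f.fO

lemma trans_symm_trans (f : Iso D E) (g : Iso D G) : f.trans (f.symm.trans g) = g := by
  refine ext_of_actEquiv ?_ ?_ ?_ ?_
  · exact (f.fN.trans_cancel_left _ g.fN).2 rfl
  · exact (f.fS.trans_cancel_left _ g.fS).2 rfl
  · rw [actEquiv_trans, actEquiv_trans, actEquiv_symm, Equiv.trans_cancel_left]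
  · rw [obsEquiv_trans, obsEquiv_trans, obsEquiv_symm, Equiv.trans_cancel_left]

lemma symm_symm (f : Iso D E) : f.symm.symm = f := by
  refine ext_of_actEquiv rfl rfl ?_ ?_
  · rw [actEquiv_symm, actEquiv_symm, Equiv.symm_symm]
  · rw [obsEquiv_symm, obsEquiv_symm, Equiv.symm_symm]

/-- Composition with a fixed isomorphism, as a bijection. -/
@[simps]
def transEquiv (f : Iso D E) : Iso E G ≃ Iso D G where
  toFun := f.trans
  invFun := f.symm.trans
  left_inv g := by simpa only [symm_symm] using f.symm.trans_symm_trans g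
  right_inv := f.trans_symm_trans

lemma push_trans (f : Iso D E) (g : Iso E G) (π : D.Policy) :
    (f.trans g).push π = g.push (f.push π) := by
  funext k
  obtain ⟨j, rfl⟩ := g.fN.surjective k
  obtain ⟨i, rfl⟩ := f.fN.surjective j
  rw [push_apply, push_apply]
  exact push_apply (f.trans g) π i

lemma coe_pushDist (f : Iso D E) (ν : ProbabilityMeasure D.Policy) :
    (f.pushDist ν : Measure E.Policy) = (ν : Measure D.Policy).map f.push :=
  rfl

lemma coe_pushDist_trans (f : Iso D E) (g : Iso E G) (ν : ProbabilityMeasure D.Policy) :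
    ((f.trans g).pushDist ν : Measure G.Policy) =
      (f.pushDist ν : Measure E.Policy).map g.push := by
  rw [coe_pushDist, coe_pushDist, Measure.map_map g.measurable_push f.measurable_push]
  exact congrArg (Measure.map · _) (funext (push_trans f g))

end Iso

/-! ### The payoff of the label-free coordination game -/

section Payoff

variable {D : DecPOMDP.{u}}

instance : Nonempty D.relabeled :=
  ⟨⟨_, Classical.arbitrary (Labeling D), rfl⟩⟩

lemma measurable_J : Measurable (J : D.Policy → ℝ) :=
  Finset.measurable_fun_sum _ fun ω _ => (measurable_trajProb ω).mul_const _

lemma integrable_J {Ω : Type*} [MeasurableSpace Ω] {μ : Measure Ω} [IsFiniteMeasure μ]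
    {X : Ω → D.Policy} (hX : Measurable X) : Integrable (fun x => J (X x)) μ :=
  integrable_finsetSum _ fun ω _ =>
    (Integrable.of_mem_Icc 0 1 ((measurable_trajProb ω).comp hX).aemeasurable
      (.of_forall fun x => trajProb_mem_Icc (X x) ω)).mul_const _

lemma integral_expect {ι : Type*} [Fintype ι] {Ω : Type*} [MeasurableSpace Ω] {μ : Measure Ω}
    {F : ι → Ω → ℝ} (hF : ∀ i, Integrable (F i) μ) :
    ∫ x, 𝔼 i, F i x ∂μ = 𝔼 i, ∫ x, F i x ∂μ := by
  simp only [Fintype.expect_eq_sum_div_card]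
  rw [integral_div, integral_finsetSum _ fun i _ => hF i]

lemma integral_pi_map {ι : Type*} [Fintype ι] {X Y : ι → Type*} [∀ i, MeasurableSpace (X i)]
    [∀ i, MeasurableSpace (Y i)] {B : Type*} [NormedAddCommGroup B] [NormedSpace ℝ B]
    {μ : ∀ i, Measure (X i)} [∀ i, IsFiniteMeasure (μ i)] {f : ∀ i, X i → Y i}
    (hf : ∀ i, Measurable (f i)) {F : (∀ i, Y i) → B}
    (hF : AEStronglyMeasurable F (Measure.pi fun i => (μ i).map (f i))) :
    ∫ y, F y ∂(Measure.pi fun i => (μ i).map (f i)) =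
      ∫ x, F (fun i => f i (x i)) ∂(Measure.pi μ) := by
  have map_eq := Measure.pi_map_pi (μ := μ) fun i => (hf i).aemeasurable
  rw [← map_eq] at hF ⊢
  exact integral_map
    (measurable_pi_lambda _ fun i => (hf i).comp (measurable_pi_apply i)).aemeasurable hF

lemma measurable_push_diagonal (φ : Fin D.N → Aut D) :
    Measurable fun (π : Fin D.N → D.Policy) (k : Fin D.N) => (φ k).push (π k) k :=
  measurable_pi_lambda _ fun k =>
    (measurable_pi_apply k).comp ((φ k).measurable_push.comp (measurable_pi_apply k))

lemma measurable_J_symmetrizer :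
    Measurable fun π : Fin D.N → D.Policy => J (fun k => symmetrizer (π k) k) := by
  simp only [J_symmetrizer, Fintype.expect_eq_sum_div_card]
  exact (Finset.measurable_fun_sum _ fun φ _ =>
    measurable_J.comp (measurable_push_diagonal φ)).div_const _

/-- The isomorphisms to `D` are those obtained from a fixed one by composition with the
automorphisms of `D`, and averaging over the latter symmetrizes. -/
lemma expect_iso_integral_J {E : Fin D.N → DecPOMDP.{v}} (f : ∀ j, Iso (E j) D)
    (ν : ∀ j, ProbabilityMeasure (E j).Policy) :
    𝔼 g : (∀ j, Iso (E j) D), ∫ π : Fin D.N → D.Policy, J (fun l => π l l)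
        ∂(Measure.pi fun k => ((g k).pushDist (ν k) : Measure D.Policy)) =
      ∫ π : Fin D.N → D.Policy, J (fun k => symmetrizer (π k) k)
        ∂(Measure.pi fun j => ((f j).pushDist (ν j) : Measure D.Policy)) := by
  have measurable_diagonal : Measurable fun π : Fin D.N → D.Policy => J (fun l => π l l) :=
    measurable_J.comp (by fun_prop)
  simp only [J_symmetrizer]
  rw [integral_expect fun φ => integrable_J (measurable_push_diagonal φ)]
  refine (Fintype.expect_equiv (Equiv.piCongrRight fun j => (f j).transEquiv) _ _ fun φ => ?_).symm
  simp only [Equiv.piCongrRight_apply, Pi.map_apply, Iso.transEquiv_apply, Iso.coe_pushDist_trans]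
  exact (integral_pi_map (fun k => (φ k).measurable_push)
    measurable_diagonal.aestronglyMeasurable).symm

lemma integral_J_symmetrizer_of_equivalent {E : Fin D.N → DecPOMDP.{v}} (f : ∀ j, Iso (E j) D)
    (ν : ∀ j, ProbabilityMeasure (E j).Policy) (ρ : Fin D.N → D.Policy)
    (h : ∀ k, ∀ᵐ p ∂(ν k : Measure (E k).Policy), Equivalent ((f k).push p) (ρ k)) :
    ∫ π : Fin D.N → D.Policy, J (fun k => symmetrizer (π k) k)
        ∂(Measure.pi fun j => ((f j).pushDist (ν j) : Measure D.Policy)) =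
      J (fun k => symmetrizer (ρ k) k) := by
  have ae_equivalent : ∀ᵐ p ∂(Measure.pi fun k => (ν k : Measure (E k).Policy)),
      ∀ k, Equivalent ((f k).push (p k)) (ρ k) :=
    ae_all_iff.2 fun k => (Measure.quasiMeasurePreserving_eval
      (fun k => (ν k : Measure (E k).Policy)) k).ae (h k)
  have ae_J_eq : ∀ᵐ p ∂(Measure.pi fun k => (ν k : Measure (E k).Policy)),
      J (fun k => symmetrizer ((f k).push (p k)) k) = J (fun k => symmetrizer (ρ k) k) := by
    filter_upwards [ae_equivalent] with p hp
    exact congrArg J (funext fun k => congrFun (hp k) k)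
  simp only [Iso.coe_pushDist]
  rw [integral_pi_map (fun k => (f k).measurable_push)
      measurable_J_symmetrizer.aestronglyMeasurable,
    integral_congr_ae ae_J_eq, integral_const, probReal_univ, one_smul]

end Payoff

end

end DecPOMDP

theorem mainTheorem6 (D : DecPOMDP.{u})
    (σ : Fin D.N → DecPOMDP.LearningAlg D.relabeled)
    (f : ∀ E : D.relabeled, DecPOMDP.Iso E.1 D) :
    D.payoff σ =
        𝔼 d : Fin D.N → D.relabeled,
          ∫ π : Fin D.N → D.Policy, DecPOMDP.J (fun k => DecPOMDP.symmetrizer (π k) k)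
            ∂(Measure.pi fun j => ((f (d j)).pushDist (σ j (d j)) : Measure D.Policy)) ∧
      ∀ ρ : Fin D.N → D.Policy,
        (∀ k, ∀ E : D.relabeled, ∀ᵐ p ∂(σ k E : Measure E.1.Policy),
          DecPOMDP.Equivalent ((f E).push p) (ρ k)) →
        D.payoff σ = DecPOMDP.J (fun k => DecPOMDP.symmetrizer (ρ k) k) := by
  have payoff_eq : D.payoff σ = 𝔼 d : Fin D.N → D.relabeled,
      ∫ π : Fin D.N → D.Policy, DecPOMDP.J (fun k => DecPOMDP.symmetrizer (π k) k)
        ∂(Measure.pi fun j => ((f (d j)).pushDist (σ j (d j)) : Measure D.Policy)) :=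
    Finset.expect_congr rfl fun d _ =>
      DecPOMDP.expect_iso_integral_J (fun j => f (d j)) fun j => σ j (d j)
  refine ⟨payoff_eq, fun ρ hρ => ?_⟩
  rw [payoff_eq, Finset.expect_congr rfl fun d _ =>
    DecPOMDP.integral_J_symmetrizer_of_equivalent (fun j => f (d j)) (fun j => σ j (d j)) ρ
      fun k => hρ k (d k)]
  exact Fintype.expect_const _
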